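/- \textbf{Theorem (Generalization bound for FedEve).} \emph{Problem.} Let $l(w;z)$, $w\in\mathbb R^d$, $z\in\mathcal Z$, be a loss that is measurable in $z$. There are $N$ clients; client $k$ has a data distribution $D_k$ on $\mathcal Z$, with $l(w;\cdot)$ integrable under $D_k$ for every $w$, and $n_k\ge 1$ training samples $z_{k,1},\dots,z_{k,n_k}\sim D_k$, all samples being independent. Put $n=\sum_k n_k$, $p_k=n_k/n$, $F_k(w)=\mathbb E_{z\sim D_k}l(w;z)$, $f=\sum_k p_kF_k$ and $\hat f(w)=\sum_k p_k\frac1{n_k}\sum_j l(w;z_{k,j})$. Assume that $f$ is bounded below. \emph{Algorithm.} FedEve starts from a random model $w_0$, independent of the data, with $\mathbb E\|w_0\|<\infty$, and a fixed momentum $M_0$. In round $t=0,\dots,T-1$ it sets $\hat w_{t+1}=w_t-\eta_gM_t$ and selects a uniformly random set $\mathcal S_t$ of $S$ clients ($1\le S\le N$). Each selected client $k$ starts at $\hat w_{t+1}$ and runs $K\ge1$ steps $w\leftarrow w-\eta_l\nabla l(w;z_{k,j})$ with constant step size $\eta_l>0$, the index $j$ being drawn uniformly from $\{1,\dots,n_k\}$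 at each step; this yields $w_t^k$. All random choices are independent of each other, of the data and of $w_0$. Then $$\Delta\tilde w_t=\sum_{k\in\mathcal S_t}a_k(\hat w_{t+1}-w_t^k),\qquad M_{t+1}=M_t+G_t(\Delta\tilde w_t-M_t),\qquad w_{t+1}=w_t-\eta_gM_{t+1},$$ where the weights are, throughout the run, $a_k=p_k$, or $a_k=p_k/\sum_{j\in\mathcal S_t}p_j$, or $a_k=1/S$ (the result holds for each choice). The gains $G_t$ come from the Kalman recursion $\hat\sigma_{t+1}^2=\sigma_t^2+\sigma_{Q_t}^2$, $G_t=\hat\sigma_{t+1}^2/(\hat\sigma_{t+1}^2+\sigma_{R_t}^2)$ (with $0/0=0$), $\sigma_{t+1}^2=(1-G_t)\hat\sigma_{t+1}^2$, with given deterministic variances $\sigma_0^2,\sigma_{Q_t}^2,\sigma_{R_t}^2\ge0$. Let $G_{kal}$ be such that $G_t\le G_{kal}$ for all $t<T$ (for a constant gain, $G_{kal}$ may be that gain). \emph{Assumptions.} For all $w,w'\in\mathbb R^d$, $z\in\mathcal Z$, all clients $k$ and all coordinates $j$: \begin{itemize} \item $|l(w;z)-l(w';z)|\le L_p\|w-w'\|$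 with $L_p\ge0$; $l(\cdot;z)$ is differentiable, and $\|\nabla l(w;z)-\nabla l(w';z)\|\le L_m\|w-w'\|$ with $L_m>0$; \item $\mathbb E_{z\sim D_k}\|\nabla l(w;z)-\nabla F_k(w)\|\le\sigma_l$, and also $\le\sigma$ (the variance constant of the convergence analysis); $\|\nabla F_k(w)-\nabla f(w)\|\le\sigma_g$; \item $|[\nabla l(w;z)]_j|\le G$. \end{itemize} Assume $\eta_l\le\frac1{L_mK(t+1)}$ for every round $t=0,\dots,T-1$, and $0<\eta_g\le\bar\eta$. \emph{Conclusion.} The generalization error $\epsilon_{gen}=\mathbb E[f(w_T)-\hat f(w_T)]$, the expectation being over $w_0$, the data and the algorithm, is well defined and satisfies $$|\epsilon_{gen}|\le C\,\frac{L_p}{nL_m}\left[T(\sigma_l+\sigma_g)+\sqrt{TL_m\Delta_0}+T\sqrt{\frac{G_{kal}^2\sigma^2}{S}}\right],\qquad \Delta_0=\mathbb E[f(w_0)]-\inf f,$$ where $C>0$ depends only on the upper bound $\bar\eta$ of the global learning rate (so $C$ is absolute for $\eta_g\le1$), and not on $d$, $N$, $\mathcal Z$, the loss, the distributions or any other parameter.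 -/

import Mathlib

open MeasureTheory

noncomputable section

namespace FedEve

/-- The space of model parameters, with its Euclidean norm. -/
abbrev Model (d : ℕ) : Type := EuclideanSpace ℝ (Fin d)

/-- A federated learning problem with `N` clients: a loss `l(w; z)`, the number `n k ≥ 1` of
training samples of client `k`, and the distribution of the data of client `k`. -/
structure Problem (Z : Type*) [MeasurableSpace Z] (d N : ℕ) where
  /-- the loss `l(w; z)` -/
  loss : Model d → Z → ℝ
  /-- the local sample sizes -/
  n : Fin N → ℕ
  n_pos : ∀ k, 0 < n k
  /-- the local data distributions -/
  dist : Fin N → Measure Z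
  isProb : ∀ k, IsProbabilityMeasure (dist k)
  measurable_loss : ∀ w, Measurable (loss w)
  integrable_loss : ∀ k w, Integrable (loss w) (dist k)

attribute [instance] Problem.isProb

variable {Z : Type*} [MeasurableSpace Z] {d N : ℕ}

namespace Problem

/-- Total number of samples. -/
def total (P : Problem Z d N) : ℕ := ∑ k, P.n k

/-- Client weights `p_k = n_k / n`. -/
def p (P : Problem Z d N) (k : Fin N) : ℝ := (P.n k : ℝ) / (P.total : ℝ)

/-- The gradient of the loss in the parameters, `∇ l(w; z)`. -/
def grad (P : Problem Z d N) (w : Model d) (z : Z) : Model d :=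
  gradient (fun v => P.loss v z) w

/-- The local objective `F_k(w) = 𝔼_{z ∼ D_k} l(w; z)`. -/
def localRisk (P : Problem Z d N) (k : Fin N) (w : Model d) : ℝ := ∫ z, P.loss w z ∂(P.dist k)

/-- The global objective `f(w) = ∑ p_k F_k(w)`. -/
def risk (P : Problem Z d N) (w : Model d) : ℝ := ∑ k, P.p k * P.localRisk k w

/-- The training data: `n k` samples for each client `k`. -/
abbrev Dataset (P : Problem Z d N) : Type _ := (k : Fin N) → Fin (P.n k) → Z

/-- The law of the training data: all samples independent, those of client `k` drawn from its
distribution. -/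
def dataLaw (P : Problem Z d N) : Measure P.Dataset :=
  Measure.pi fun k => Measure.pi fun _ : Fin (P.n k) => P.dist k

/-- The empirical objective `∑ p_k (1 / n_k) ∑_j l(w; z_{k,j})`. -/
def empRisk (P : Problem Z d N) (D : P.Dataset) (w : Model d) : ℝ :=
  ∑ k, P.p k * ((∑ j, P.loss w (D k j)) / (P.n k : ℝ))

/-- The loss is `Lp`-Lipschitz and `Lm`-smooth in the parameters, for every `z`. -/
def LipschitzSmooth (P : Problem Z d N) (Lp Lm : ℝ) : Prop :=
  (∀ z w w', |P.loss w z - P.loss w' z| ≤ Lp * ‖w - w'‖) ∧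
  (∀ z, Differentiable ℝ fun w => P.loss w z) ∧
  ∀ z w w', ‖P.grad w z - P.grad w' z‖ ≤ Lm * ‖w - w'‖

/-- Bounded local variance: `𝔼_{z ∼ D_k} ‖∇ l(w; z) - ∇ F_k(w)‖ ≤ σ` for all `k`, `w`. -/
def LocalVariance (P : Problem Z d N) (σ : ℝ) : Prop :=
  ∀ k w, ∫ z, ‖P.grad w z - gradient (P.localRisk k) w‖ ∂(P.dist k) ≤ σ

/-- Bounded global variance: `‖∇ F_k(w) - ∇ f(w)‖ ≤ σ` for all `k`, `w`. -/
def GlobalVariance (P : Problem Z d N) (σ : ℝ) : Prop :=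
  ∀ k w, ‖gradient (P.localRisk k) w - gradient P.risk w‖ ≤ σ

/-- Every coordinate of every sample gradient is bounded by `G`. -/
def BoundedGradients (P : Problem Z d N) (G : ℝ) : Prop :=
  ∀ w z (j : Fin d), |P.grad w z j| ≤ G

/-- `Δ₀ = 𝔼[f(w₀)] - inf f`, for an initial model `w₀` of law `μ₀`. -/
def initialGap (P : Problem Z d N) (μ₀ : Measure (Model d)) : ℝ :=
  ∫ w, (P.risk w - ⨅ v, P.risk v) ∂μ₀

end Problem

/-- The three ways of weighting the updates of the selected clients: by `p_k`, by `p_k`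
renormalized over the selected clients, or uniformly. -/
inductive Weighting
  | total
  | selected
  | uniform

/-- The weight of the update of client `k` when the clients in `A` are selected. -/
def Problem.weight (P : Problem Z d N) : Weighting → Finset (Fin N) → Fin N → ℝ
  | .total, _, k => P.p k
  | .selected, A, k => P.p k / ∑ j ∈ A, P.p j
  | .uniform, A, _ => 1 / (A.card : ℝ)

/-- The parameters of the algorithm: local and global learning rates, the initial momentum, the
initial model variance `σ₀²`, the variances `σ_{Q_t}²`, `σ_{R_t}²` of period and client drift, and
the weighting of the selected clients. -/
structure Config (d : ℕ) where
  ηl : ℝ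
  ηg : ℝ
  M₀ : Model d
  var₀ : ℝ
  varQ : ℕ → ℝ
  varR : ℕ → ℝ
  weighting : Weighting

namespace Config

/-- The model variance `σ_t²`: `σ̂² = σ_t² + σ_{Q_t}²`, `G = σ̂² / (σ̂² + σ_{R_t}²)`,
`σ_{t+1}² = (1 - G) σ̂²`. -/
def var (c : Config d) : ℕ → ℝ
  | 0 => c.var₀
  | t + 1 =>
    (1 - (c.var t + c.varQ t) / (c.var t + c.varQ t + c.varR t)) * (c.var t + c.varQ t)

/-- The Kalman gain of round `t`. -/
def gain (c : Config d) (t : ℕ) : ℝ :=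
  (c.var t + c.varQ t) / (c.var t + c.varQ t + c.varR t)

end Config

/-- `K` steps of local SGD on the samples `D` of one client, started at `w`; step `i` uses the
sample of index `idx i`. -/
def localSGD (P : Problem Z d N) (ηl : ℝ) {m : ℕ} (D : Fin m → Z) (w : Model d) :
    (K : ℕ) → (Fin K → Fin m) → Model d
  | 0, _ => w
  | K + 1, idx =>
    let v := localSGD P ηl D w K fun i => idx i.castSucc
    v - ηl • P.grad v (D (idx (Fin.last K)))

/-- The random choices of one round: the set of `S` selected clients, and for each client the
indices of the samples that its `K` local steps use. -/
abbrev RoundSeed (P : Problem Z d N) (S K : ℕ) : Type :=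
  {A : Finset (Fin N) // A.card = S} × ((k : Fin N) → Fin K → Fin (P.n k))

/-- The averaged client update `Δ̃ = ∑_{k ∈ A} a_k (ŵ - w^k)`, with local SGD started at `ŵ`. -/
def clientUpdate (P : Problem Z d N) (c : Config d) {S K : ℕ} (D : P.Dataset)
    (ω : RoundSeed P S K) (wHat : Model d) : Model d :=
  ∑ k ∈ ω.1.1,
    P.weight c.weighting ω.1.1 k • (wHat - localSGD P c.ηl (D k) wHat K (ω.2 k))

/-- The model and the momentum `(w_T, M_T)` after `T` rounds. -/
def run (P : Problem Z d N) (c : Config d) {S K : ℕ} (D : P.Dataset) (w₀ : Model d) :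
    (T : ℕ) → (Fin T → RoundSeed P S K) → Model d × Model d
  | 0, _ => (w₀, c.M₀)
  | t + 1, ω =>
    let s := run P c D w₀ t fun i => ω i.castSucc
    let wHat := s.1 - c.ηg • s.2
    let M := s.2 + c.gain t • (clientUpdate P c D (ω (Fin.last t)) wHat - s.2)
    (s.1 - c.ηg • M, M)

/-- The generalization gap `f(w_T) - f̂(w_T)` for the initial model and the training data `x`,
averaged over the random choices of the algorithm, which are independent and uniform. -/
def gap (P : Problem Z d N) (c : Config d) (S K T : ℕ) (x : Model d × P.Dataset) : ℝ :=
  (∑ ω : Fin T → RoundSeed P S K,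
      (P.risk (run P c x.2 x.1 T ω).1 - P.empRisk x.2 (run P c x.2 x.1 T ω).1)) /
    (Fintype.card (Fin T → RoundSeed P S K) : ℝ)

/-- The generalization error `𝔼[f(w_T) - f̂(w_T)]`, the expectation being over the initial model,
the training data and the algorithm. -/
def genError (P : Problem Z d N) (c : Config d) (μ₀ : Measure (Model d)) (S K T : ℕ) : ℝ :=
  ∫ x, gap P c S K T x ∂(μ₀.prod P.dataLaw)

end FedEve

end

/-! Since p_k / n_k = 1/n, the gap f - f̂ at a model is the plain average over all n samples s = (k,
j) of the excess F_k(w) - l(w; z_s). The random choices of the algorithm are held fixed until the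
end, and each sample is treated by stability. Instead of exchanging z_s for an independent copy, a
second run calls ∇F_k wherever the first calls ∇l(·; z_s). The second final model does not depend on
z_s, so its expected excess at s is zero (`Problem.integral_excess_eq_zero`), and the excess of the
true run is at most 2 L_p times the expected distance of the two final models.

That distance is at most a constant times T times the oracle error accumulated along the second run
(`norm_oracleRun_fst_sub_le`). Local descent amplifies differences by at most (1 + η_l L_m)^K ≤ 1 +
2/T per round. Momentum averages convexly, so amplification over T rounds stays bounded in terms of
η_g.

The error is evaluated at points independent of z_s, hence each call costs at most σ_l in
expectation. One call uses one sample, so it contributes to one s only: summed over all s, the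
errors cost at most T K η_l σ_l ≤ σ_l / L_m (`Problem.sum_integral_runError_le`). Together this
gives a multiple of L_p T σ_l / (n L_m), one of the terms of the claimed bound, whose other terms
are nonnegative. -/

namespace FedEve

/-! ### Stability of local gradient descent. -/

section Descent

variable {E : Type*} [NormedAddCommGroup E] [NormedSpace ℝ E]

/-- `K` steps of gradient descent with step size `η`, step `i` following the field `V (idx i)`. -/
noncomputable def descent (η : ℝ) {m : ℕ} (V : Fin m → E → E) (w : E) :
    (K : ℕ) → (Fin K → Fin m) → E
  | 0, _ => w
  | K + 1, idx =>
    descent η V w K (fun i => idx i.castSucc) -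
      η • V (idx (Fin.last K)) (descent η V w K fun i => idx i.castSucc)

/-- The accumulated difference of the fields `V` and `W` along a descent path of `W`. -/
noncomputable def descentError (η : ℝ) {m : ℕ} (V W : Fin m → E → E) (w : E) :
    (K : ℕ) → (Fin K → Fin m) → ℝ
  | 0, _ => 0
  | K + 1, idx =>
    descentError η V W w K (fun i => idx i.castSucc) +
      η * ‖V (idx (Fin.last K)) (descent η W w K fun i => idx i.castSucc) -
        W (idx (Fin.last K)) (descent η W w K fun i => idx i.castSucc)‖

theorem descentError_nonneg {η : ℝ} (hη : 0 ≤ η) {m : ℕ} (V W : Fin m → E → E) (w : E) (K : ℕ)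
    (idx : Fin K → Fin m) : 0 ≤ descentError η V W w K idx := by
  induction K with
  | zero => exact le_rfl
  | succ K ih => exact add_nonneg (ih _) (mul_nonneg hη (norm_nonneg _))

theorem norm_sub_descent_le {η : ℝ} (hη : 0 ≤ η) {m : ℕ} {V : Fin m → E → E} {B : ℝ}
    (hV : ∀ j w, ‖V j w‖ ≤ B) (w : E) (K : ℕ) (idx : Fin K → Fin m) :
    ‖w - descent η V w K idx‖ ≤ K * (η * B) := by
  induction K with
  | zero => simp [descent]
  | succ K ih =>
    have h1 := ih fun i => idx i.castSucc
    rw [descent]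
    set v := descent η V w K fun i => idx i.castSucc
    have h2 : ‖η • V (idx (Fin.last K)) v‖ ≤ η * B := by
      rw [norm_smul, Real.norm_of_nonneg hη]
      exact mul_le_mul_of_nonneg_left (hV _ _) hη
    calc ‖w - (v - η • V (idx (Fin.last K)) v)‖ = ‖(w - v) + η • V (idx (Fin.last K)) v‖ := by
          congr 1; abel
      _ ≤ K * (η * B) + η * B := (norm_add_le _ _).trans (add_le_add h1 h2)
      _ = _ := by push_cast; ring

/-- Stability of the total displacement of gradient descent under a change of the starting point
and of the fields. -/
theorem norm_displacement_sub_le {η : ℝ} (hη : 0 ≤ η) {L : ℝ} (hL : 0 ≤ L) {m : ℕ}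
    {V : Fin m → E → E} (W : Fin m → E → E)
    (hV : ∀ j w w', ‖V j w - V j w'‖ ≤ L * ‖w - w'‖) (w w' : E) (K : ℕ) (idx : Fin K → Fin m) :
    ‖(w - descent η V w K idx) - (w' - descent η W w' K idx)‖ ≤
      (1 + η * L) ^ K * (‖w - w'‖ + descentError η V W w' K idx) - ‖w - w'‖ := by
  induction K with
  | zero => simp [descent, descentError]
  | succ K ih =>
    have h1 := ih fun i => idx i.castSucc
    rw [descent, descent, descentError]
    set v := descent η V w K fun i => idx i.castSucc
    set v' := descent η W w' K fun i => idx i.castSucc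
    set Ψ := descentError η V W w' K fun i => idx i.castSucc
    set j := idx (Fin.last K)
    set u := (w - v) - (w' - v') with hu
    have h2 : ‖v - v'‖ ≤ ‖w - w'‖ + ‖u‖ := by
      have : v - v' = (w - w') - u := by rw [hu]; abel
      rw [this]; exact norm_sub_le _ _
    have h3 : ‖V j v - W j v'‖ ≤ L * (‖w - w'‖ + ‖u‖) + ‖V j v' - W j v'‖ := by
      have : V j v - W j v' = (V j v - V j v') + (V j v' - W j v') := by abel
      rw [this]
      refine (norm_add_le _ _).trans (add_le_add ((hV j v v').trans ?_) le_rfl)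
      exact mul_le_mul_of_nonneg_left h2 hL
    have h4 : ‖(w - (v - η • V j v)) - (w' - (v' - η • W j v'))‖ ≤
        ‖u‖ + η * (L * (‖w - w'‖ + ‖u‖) + ‖V j v' - W j v'‖) := by
      have : (w - (v - η • V j v)) - (w' - (v' - η • W j v')) = u + η • (V j v - W j v') := by
        rw [hu, smul_sub]; abel
      rw [this]
      refine (norm_add_le _ _).trans (add_le_add le_rfl ?_)
      rw [norm_smul, Real.norm_of_nonneg hη]
      exact mul_le_mul_of_nonneg_left h3 hη
    have h5 : (1 + η * L) * ‖u‖ ≤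
        (1 + η * L) * ((1 + η * L) ^ K * (‖w - w'‖ + Ψ) - ‖w - w'‖) :=
      mul_le_mul_of_nonneg_left h1 (by positivity)
    -- The newest error enters with factor 1; enlarging this to the full power keeps the bound in
    -- closed form.
    have h6 : 1 * (η * ‖V j v' - W j v'‖) ≤ (1 + η * L) ^ (K + 1) * (η * ‖V j v' - W j v'‖) :=
      mul_le_mul_of_nonneg_right (one_le_pow₀ (by nlinarith [mul_nonneg hη hL])) (by positivity)
    calc _ ≤ _ := h4
      _ = (1 + η * L) * ‖u‖ + η * L * ‖w - w'‖ + 1 * (η * ‖V j v' - W j v'‖) := by ring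
      _ ≤ (1 + η * L) * ((1 + η * L) ^ K * (‖w - w'‖ + Ψ) - ‖w - w'‖) + η * L * ‖w - w'‖ +
          (1 + η * L) ^ (K + 1) * (η * ‖V j v' - W j v'‖) := by linarith
      _ = _ := by ring

theorem one_add_pow_le_of_mul_le {a τ : ℝ} (ha : 0 ≤ a) (hτ : 1 ≤ τ) {K : ℕ}
    (h : K * a * τ ≤ 1) : (1 + a) ^ K ≤ 1 + 2 / τ := by
  have hτ0 : 0 < τ := by linarith
  have hx : K * a ≤ 1 / τ := by rwa [le_div_iff₀ hτ0]
  have hx0 : 0 ≤ K * a := by positivity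
  have h1 : 1 / τ ≤ 1 := by rw [div_le_one hτ0]; exact hτ
  have h2 : (1 + a) ^ K ≤ Real.exp (K * a) := by
    rw [Real.exp_nat_mul]
    exact pow_le_pow_left₀ (by positivity) (by linarith [Real.add_one_le_exp a]) K
  -- On [0, 1], exp x ≤ 1 + x + x² ≤ 1 + 2x, used with x = K a ≤ 1/τ.
  have h3 := Real.abs_exp_sub_one_sub_id_le (x := K * a) (by rw [abs_of_nonneg hx0]; linarith)
  have h4 := (abs_le.mp h3).2
  have h5 : 2 / τ = 2 * (1 / τ) := by ring
  rw [h5]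
  nlinarith

end Descent

/-! ### Runs driven by an arbitrary gradient oracle. -/

variable {Z : Type*} [MeasurableSpace Z] {d N : ℕ}

/-- A family of fields in the place of the sample gradients, one for each sample. -/
abbrev Problem.Oracle (P : Problem Z d N) : Type _ :=
  (k : Fin N) → Fin (P.n k) → Model d → Model d

/-- The averaged client update computed from an oracle. -/
noncomputable def oracleUpdate (P : Problem Z d N) (c : Config d) {S K : ℕ} (V : P.Oracle)
    (ω : RoundSeed P S K) (wHat : Model d) : Model d :=
  ∑ k ∈ ω.1.1, P.weight c.weighting ω.1.1 k • (wHat - descent c.ηl (V k) wHat K (ω.2 k))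

/-- The model and the momentum after `T` rounds that use an oracle. -/
noncomputable def oracleRun (P : Problem Z d N) (c : Config d) {S K : ℕ} (V : P.Oracle)
    (w₀ : Model d) : (T : ℕ) → (Fin T → RoundSeed P S K) → Model d × Model d
  | 0, _ => (w₀, c.M₀)
  | t + 1, ω =>
    let s := oracleRun P c V w₀ t fun i => ω i.castSucc
    let wHat := s.1 - c.ηg • s.2
    let M := s.2 + c.gain t • (oracleUpdate P c V (ω (Fin.last t)) wHat - s.2)
    (s.1 - c.ηg • M, M)

/-- The starting point of the local descents in the round after the first `t`. -/
noncomputable def oracleLookahead (P : Problem Z d N) (c : Config d) {S K : ℕ} (V : P.Oracle)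
    (w₀ : Model d) (t : ℕ) (ω : Fin t → RoundSeed P S K) : Model d :=
  (oracleRun P c V w₀ t ω).1 - c.ηg • (oracleRun P c V w₀ t ω).2

/-- The weighted difference of two oracles in one round that starts at `wHat`. -/
noncomputable def roundError (P : Problem Z d N) (c : Config d) {S K : ℕ} (V W : P.Oracle)
    (ω : RoundSeed P S K) (wHat : Model d) : ℝ :=
  ∑ k ∈ ω.1.1, P.weight c.weighting ω.1.1 k * descentError c.ηl (V k) (W k) wHat K (ω.2 k)

/-- The accumulated difference of two oracles along the run of the second. -/
noncomputable def runError (P : Problem Z d N) (c : Config d) {S K : ℕ} (V W : P.Oracle)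
    (w₀ : Model d) : (T : ℕ) → (Fin T → RoundSeed P S K) → ℝ
  | 0, _ => 0
  | t + 1, ω =>
    runError P c V W w₀ t (fun i => ω i.castSucc) +
      roundError P c V W (ω (Fin.last t)) (oracleLookahead P c W w₀ t fun i => ω i.castSucc)

/-- The oracle of the sample gradients on a dataset. -/
noncomputable def Problem.sampleOracle (P : Problem Z d N) (D : P.Dataset) : P.Oracle :=
  fun k j w => P.grad w (D k j)

theorem run_eq_oracleRun (P : Problem Z d N) (c : Config d) {S K : ℕ} (D : P.Dataset)
    (w₀ : Model d) (T : ℕ) (ω : Fin T → RoundSeed P S K) :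
    run P c D w₀ T ω = oracleRun P c (P.sampleOracle D) w₀ T ω := by
  have hl : ∀ (k : Fin N) (w : Model d) (K : ℕ) (idx : Fin K → Fin (P.n k)),
      localSGD P c.ηl (D k) w K idx = descent c.ηl (P.sampleOracle D k) w K idx := by
    intro k w K idx
    induction K with
    | zero => rfl
    | succ K ih => simp only [localSGD, descent, ih, Problem.sampleOracle]
  induction T with
  | zero => rfl
  | succ T ih => simp only [run, oracleRun, ih, clientUpdate, oracleUpdate, hl]

/-! ### Client weights and Kalman gains. -/

theorem Problem.p_nonneg (P : Problem Z d N) (k : Fin N) : 0 ≤ P.p k := by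
  unfold Problem.p; positivity

theorem Problem.weight_nonneg (P : Problem Z d N) (o : Weighting) (A : Finset (Fin N))
    (k : Fin N) : 0 ≤ P.weight o A k := by
  cases o with
  | total => exact P.p_nonneg k
  | selected => exact div_nonneg (P.p_nonneg k) (Finset.sum_nonneg fun j _ => P.p_nonneg j)
  | uniform => simp only [Problem.weight]; positivity

theorem Problem.sum_p_le_one (P : Problem Z d N) : ∑ k, P.p k ≤ 1 := by
  have : ∑ k, P.p k = (P.total : ℝ) / P.total := by
    simp only [Problem.p, ← Finset.sum_div]
    congr 1
    simp [Problem.total]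
  rw [this]
  exact div_self_le_one _

/-- An inequality is all that the three weightings share: with `total` only the selected part of the
p_k is summed, and an empty selection gives 0/0 = 0. -/
theorem Problem.sum_weight_le_one (P : Problem Z d N) (o : Weighting) (A : Finset (Fin N)) :
    ∑ k ∈ A, P.weight o A k ≤ 1 := by
  cases o with
  | total =>
    exact (Finset.sum_le_univ_sum_of_nonneg P.p_nonneg).trans P.sum_p_le_one
  | selected =>
    simp only [Problem.weight, ← Finset.sum_div]
    exact div_self_le_one _
  | uniform =>
    simp only [Problem.weight, Finset.sum_const, nsmul_eq_mul, mul_one_div]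
    exact div_self_le_one _

theorem Problem.sum_weight_mul_le (P : Problem Z d N) (o : Weighting) (A : Finset (Fin N))
    {f : Fin N → ℝ} {b : ℝ} (hb : 0 ≤ b) (hf : ∀ k, f k ≤ b) :
    ∑ k ∈ A, P.weight o A k * f k ≤ b := by
  calc ∑ k ∈ A, P.weight o A k * f k ≤ ∑ k ∈ A, P.weight o A k * b :=
        Finset.sum_le_sum fun k _ => mul_le_mul_of_nonneg_left (hf k) (P.weight_nonneg o A k)
    _ = (∑ k ∈ A, P.weight o A k) * b := by rw [Finset.sum_mul]
    _ ≤ b := mul_le_of_le_one_left hb (P.sum_weight_le_one o A)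

theorem Problem.norm_sum_weight_smul_le (P : Problem Z d N) (o : Weighting) (A : Finset (Fin N))
    (f : Fin N → Model d) :
    ‖∑ k ∈ A, P.weight o A k • f k‖ ≤ ∑ k ∈ A, P.weight o A k * ‖f k‖ := by
  refine (norm_sum_le _ _).trans (Finset.sum_le_sum fun k _ => ?_)
  rw [norm_smul, Real.norm_of_nonneg (P.weight_nonneg o A k)]

theorem roundError_nonneg (P : Problem Z d N) {c : Config d} (hη : 0 ≤ c.ηl) {S K : ℕ}
    (V W : P.Oracle) (ω : RoundSeed P S K) (wHat : Model d) : 0 ≤ roundError P c V W ω wHat :=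
  Finset.sum_nonneg fun _ _ =>
    mul_nonneg (P.weight_nonneg _ _ _) (descentError_nonneg hη _ _ _ _ _)

theorem runError_nonneg (P : Problem Z d N) {c : Config d} (hη : 0 ≤ c.ηl) {S K : ℕ}
    (V W : P.Oracle) (w₀ : Model d) (T : ℕ) (ω : Fin T → RoundSeed P S K) :
    0 ≤ runError P c V W w₀ T ω := by
  induction T with
  | zero => exact le_rfl
  | succ T ih => exact add_nonneg (ih _) (roundError_nonneg P hη _ _ _ _)

theorem Config.var_nonneg {c : Config d} (h₀ : 0 ≤ c.var₀) (hQ : ∀ t, 0 ≤ c.varQ t)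
    (hR : ∀ t, 0 ≤ c.varR t) (t : ℕ) : 0 ≤ c.var t := by
  induction t with
  | zero => exact h₀
  | succ t ih =>
    have h1 := hQ t
    have h2 := hR t
    rw [Config.var]
    refine mul_nonneg (sub_nonneg.mpr (div_le_one_of_le₀ ?_ ?_)) ?_ <;> linarith

theorem Config.gain_nonneg {c : Config d} (h₀ : 0 ≤ c.var₀) (hQ : ∀ t, 0 ≤ c.varQ t)
    (hR : ∀ t, 0 ≤ c.varR t) (t : ℕ) : 0 ≤ c.gain t := by
  have h1 := hQ t
  have h2 := hR t
  have h3 := Config.var_nonneg h₀ hQ hR t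
  unfold Config.gain
  positivity

theorem Config.gain_le_one {c : Config d} (h₀ : 0 ≤ c.var₀) (hQ : ∀ t, 0 ≤ c.varQ t)
    (hR : ∀ t, 0 ≤ c.varR t) (t : ℕ) : c.gain t ≤ 1 := by
  have h1 := hQ t
  have h2 := hR t
  have h3 := Config.var_nonneg h₀ hQ hR t
  exact div_le_one_of_le₀ (by linarith) (by linarith)

/-! ### Stability of the whole run. -/

theorem norm_oracleUpdate_le (P : Problem Z d N) {c : Config d} (hη : 0 ≤ c.ηl) {S K : ℕ}
    {V : P.Oracle} {B : ℝ} (hB : 0 ≤ B) (hV : ∀ k j w, ‖V k j w‖ ≤ B) (ω : RoundSeed P S K)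
    (wHat : Model d) : ‖oracleUpdate P c V ω wHat‖ ≤ K * (c.ηl * B) :=
  (P.norm_sum_weight_smul_le _ _ _).trans <|
    P.sum_weight_mul_le _ _ (by positivity) fun k =>
      norm_sub_descent_le hη (hV k) wHat K (ω.2 k)

/-- The momentum is a convex combination of the old momentum and the client update. -/
theorem norm_convex_step_le {E : Type*} [NormedAddCommGroup E] [NormedSpace ℝ E] {g : ℝ}
    (hg0 : 0 ≤ g) (hg1 : g ≤ 1) {m u : E} {b : ℝ} (hm : ‖m‖ ≤ b) (hu : ‖u‖ ≤ b) :
    ‖m + g • (u - m)‖ ≤ b := by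
  have : m + g • (u - m) = (1 - g) • m + g • u := by module
  rw [this]
  refine (norm_add_le _ _).trans ?_
  rw [norm_smul, norm_smul, Real.norm_of_nonneg hg0, Real.norm_of_nonneg (sub_nonneg.mpr hg1)]
  nlinarith [mul_le_mul_of_nonneg_left hu hg0,
    mul_le_mul_of_nonneg_left hm (sub_nonneg.mpr hg1)]

/-- With bounded fields the run stays within a bounded distance of its starting point. -/
theorem norm_oracleRun_le (P : Problem Z d N) {c : Config d} (hη : 0 ≤ c.ηl) (hg : 0 ≤ c.ηg)
    (hG0 : ∀ t, 0 ≤ c.gain t) (hG1 : ∀ t, c.gain t ≤ 1) {S K : ℕ}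
    {V : P.Oracle} {B : ℝ} (hB : 0 ≤ B) (hV : ∀ k j w, ‖V k j w‖ ≤ B) (w₀ : Model d) (T : ℕ)
    (ω : Fin T → RoundSeed P S K) :
    ‖(oracleRun P c V w₀ T ω).2‖ ≤ ‖c.M₀‖ + K * (c.ηl * B) ∧
      ‖(oracleRun P c V w₀ T ω).1 - w₀‖ ≤ T * (c.ηg * (‖c.M₀‖ + K * (c.ηl * B))) := by
  have hKB : 0 ≤ K * (c.ηl * B) := by positivity
  induction T with
  | zero => simp [oracleRun, hKB]
  | succ t ih =>
    obtain ⟨h1, h2⟩ := ih fun i => ω i.castSucc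
    rw [oracleRun]
    set s := oracleRun P c V w₀ t fun i => ω i.castSucc
    set M := s.2 + c.gain t • (oracleUpdate P c V (ω (Fin.last t)) (s.1 - c.ηg • s.2) - s.2)
    have hM : ‖M‖ ≤ ‖c.M₀‖ + K * (c.ηl * B) :=
      norm_convex_step_le (hG0 t) (hG1 t) h1
        ((norm_oracleUpdate_le P hη hB hV _ _).trans (by linarith [norm_nonneg c.M₀]))
    refine ⟨hM, ?_⟩
    have : s.1 - c.ηg • M - w₀ = (s.1 - w₀) - c.ηg • M := by abel
    simp only
    rw [this]
    refine (norm_sub_le _ _).trans ?_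
    rw [norm_smul, Real.norm_of_nonneg hg]
    push_cast
    nlinarith [mul_le_mul_of_nonneg_left hM hg]

/-- The update is a displacement, so a shift common to start and end cancels. The starting points
therefore enter only with (1 + η_l L)^K - 1 ≤ 2/τ, which is small enough to survive τ = T rounds. -/
theorem norm_oracleUpdate_sub_le (P : Problem Z d N) {c : Config d} (hη : 0 ≤ c.ηl) {S K : ℕ}
    {L τ : ℝ} (hL : 0 ≤ L) (hτ : 1 ≤ τ) (hηL : K * (c.ηl * L) * τ ≤ 1)
    {V : P.Oracle} (W : P.Oracle)
    (hV : ∀ k j w w', ‖V k j w - V k j w'‖ ≤ L * ‖w - w'‖) (ω : RoundSeed P S K)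
    (w w' : Model d) :
    ‖oracleUpdate P c V ω w - oracleUpdate P c W ω w'‖ ≤
      2 / τ * ‖w - w'‖ + 3 * roundError P c V W ω w' := by
  have hτ0 : 0 < τ := by linarith
  have hpow := one_add_pow_le_of_mul_le (a := c.ηl * L) (by positivity) hτ hηL
  -- Source of the factor 3: the oracle error is multiplied by 1 + 2/τ ≤ 3.
  have h2τ : 2 / τ ≤ 2 := by rw [div_le_iff₀ hτ0]; linarith
  rw [oracleUpdate, oracleUpdate, ← Finset.sum_sub_distrib]
  simp only [← smul_sub]
  refine (P.norm_sum_weight_smul_le _ _ _).trans ?_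
  calc _ ≤ ∑ k ∈ ω.1.1, P.weight c.weighting ω.1.1 k *
        (2 / τ * ‖w - w'‖ + 3 * descentError c.ηl (V k) (W k) w' K (ω.2 k)) := by
        refine Finset.sum_le_sum fun k _ =>
          mul_le_mul_of_nonneg_left ?_ (P.weight_nonneg _ _ _)
        refine (norm_displacement_sub_le hη hL (W k) (hV k) w w' K (ω.2 k)).trans ?_
        have hΨ := descentError_nonneg hη (V k) (W k) w' K (ω.2 k)
        have h1 := mul_le_mul_of_nonneg_right hpow (add_nonneg (norm_nonneg (w - w')) hΨ)
        nlinarith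
    _ = ∑ k ∈ ω.1.1, P.weight c.weighting ω.1.1 k * (2 / τ * ‖w - w'‖) +
        3 * roundError P c V W ω w' := by
        rw [roundError, Finset.mul_sum, ← Finset.sum_add_distrib]
        exact Finset.sum_congr rfl fun k _ => by ring
    _ ≤ _ := by
        gcongr
        exact P.sum_weight_mul_le _ _ (by positivity) fun _ => le_rfl

/-- Stability of the run under a change of the oracle. -/
theorem norm_oracleRun_sub_le (P : Problem Z d N) {c : Config d} (hη : 0 ≤ c.ηl)
    (hg : 0 ≤ c.ηg) (hG0 : ∀ t, 0 ≤ c.gain t) (hG1 : ∀ t, c.gain t ≤ 1) {S K : ℕ}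
    {L τ : ℝ} (hL : 0 ≤ L) (hτ : 1 ≤ τ) (hηL : K * (c.ηl * L) * τ ≤ 1)
    {V : P.Oracle} (W : P.Oracle)
    (hV : ∀ k j w w', ‖V k j w - V k j w'‖ ≤ L * ‖w - w'‖) (w₀ : Model d) (T : ℕ)
    (ω : Fin T → RoundSeed P S K) {Q : ℝ} (hQ : runError P c V W w₀ T ω ≤ Q) :
    ‖(oracleRun P c V w₀ T ω).2 - (oracleRun P c W w₀ T ω).2‖ ≤
        3 * Q * (1 + 4 * c.ηg / τ) ^ T ∧
      ‖(oracleRun P c V w₀ T ω).1 - (oracleRun P c W w₀ T ω).1‖ ≤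
        3 * Q * τ * (1 + 4 * c.ηg / τ) * ((1 + 4 * c.ηg / τ) ^ T - 1) / 4 := by
  have hτ0 : 0 < τ := by linarith
  induction T with
  | zero =>
    have : 0 ≤ Q := hQ
    simpa [oracleRun] using this
  | succ t ih =>
    have hE := runError_nonneg P hη V W w₀ t fun i => ω i.castSucc
    have hR := roundError_nonneg P hη V W (ω (Fin.last t))
      (oracleLookahead P c W w₀ t fun i => ω i.castSucc)
    rw [runError] at hQ
    have hQ0 : 0 ≤ Q := by linarith
    obtain ⟨h1, h2⟩ := ih (fun i => ω i.castSucc) (by linarith)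
    rw [oracleRun, oracleRun]
    rw [oracleLookahead] at hQ hR
    set s := oracleRun P c V w₀ t fun i => ω i.castSucc
    set r := oracleRun P c W w₀ t fun i => ω i.castSucc
    set ρ := 1 + 4 * c.ηg / τ with hρ
    have hρ1 : 1 ≤ ρ := by rw [hρ]; have : 0 ≤ 4 * c.ηg / τ := by positivity
                           linarith
    have hρt : 1 ≤ ρ ^ t := one_le_pow₀ hρ1
    -- With this relation, the model bound is the geometric sum of the momentum bounds η_g · 3Qρ^i
    -- over i = 1, …, t.
    have hρτ : c.ηg = τ * (ρ - 1) / 4 := by rw [hρ]; field_simp; ring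
    have hw : ‖(s.1 - c.ηg • s.2) - (r.1 - c.ηg • r.2)‖ ≤ 3 * Q * τ * ρ * (ρ ^ t - 1) / 4 +
        c.ηg * (3 * Q * ρ ^ t) := by
      have : (s.1 - c.ηg • s.2) - (r.1 - c.ηg • r.2) = (s.1 - r.1) - c.ηg • (s.2 - r.2) := by
        rw [smul_sub]; abel
      rw [this]
      refine (norm_sub_le _ _).trans (add_le_add h2 ?_)
      rw [norm_smul, Real.norm_of_nonneg hg]
      exact mul_le_mul_of_nonneg_left h1 hg
    have hu := norm_oracleUpdate_sub_le P hη hL hτ hηL W hV (ω (Fin.last t))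
      (s.1 - c.ηg • s.2) (r.1 - c.ηg • r.2)
    set u := oracleUpdate P c V (ω (Fin.last t)) (s.1 - c.ηg • s.2)
    set u' := oracleUpdate P c W (ω (Fin.last t)) (r.1 - c.ηg • r.2)
    have hu' : ‖u - u'‖ ≤ 3 * Q * ρ ^ (t + 1) := by
      have h3 : 2 / τ * ‖(s.1 - c.ηg • s.2) - (r.1 - c.ηg • r.2)‖ ≤
          2 / τ * (3 * Q * τ * ρ * (ρ ^ t - 1) / 4 + c.ηg * (3 * Q * ρ ^ t)) :=
        mul_le_mul_of_nonneg_left hw (by positivity)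
      have h4 : 2 / τ * (3 * Q * τ * ρ * (ρ ^ t - 1) / 4 + c.ηg * (3 * Q * ρ ^ t)) =
          3 * Q * ρ ^ (t + 1) - 3 * Q * (ρ + ρ ^ t) / 2 := by
        rw [hρτ]; field_simp; ring
      -- The slack 3Q(ρ + ρ^t)/2 ≥ 3Q pays for the oracle error of this round, which is itself at
      -- most Q.
      have h5 : 3 * Q * 1 ≤ 3 * Q * ((ρ + ρ ^ t) / 2) :=
        mul_le_mul_of_nonneg_left (by linarith) (by linarith)
      linarith
    have hm' : ‖s.2 - r.2‖ ≤ 3 * Q * ρ ^ (t + 1) :=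
      h1.trans (mul_le_mul_of_nonneg_left (pow_le_pow_right₀ hρ1 (Nat.le_succ t)) (by linarith))
    have hM : ‖(s.2 + c.gain t • (u - s.2)) - (r.2 + c.gain t • (u' - r.2))‖ ≤
        3 * Q * ρ ^ (t + 1) := by
      have : (s.2 + c.gain t • (u - s.2)) - (r.2 + c.gain t • (u' - r.2)) =
          (s.2 - r.2) + c.gain t • ((u - u') - (s.2 - r.2)) := by module
      rw [this]
      exact norm_convex_step_le (hG0 t) (hG1 t) hm' hu'
    refine ⟨hM, ?_⟩
    simp only
    set M := s.2 + c.gain t • (u - s.2)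
    set M' := r.2 + c.gain t • (u' - r.2)
    have : (s.1 - c.ηg • M) - (r.1 - c.ηg • M') = (s.1 - r.1) - c.ηg • (M - M') := by
      rw [smul_sub]; abel
    rw [this]
    refine (norm_sub_le _ _).trans ?_
    rw [norm_smul, Real.norm_of_nonneg hg]
    calc _ ≤ 3 * Q * τ * ρ * (ρ ^ t - 1) / 4 + c.ηg * (3 * Q * ρ ^ (t + 1)) :=
          add_le_add h2 (mul_le_mul_of_nonneg_left hM hg)
      _ = _ := by rw [hρτ]; ring

/-- The constant in the stability bound, for a global learning rate at most `h`. -/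
noncomputable def stabilityConst (h : ℝ) : ℝ := (1 + 4 * h) * Real.exp (4 * h)

/-- Stability of the models after `T` rounds with `K` local steps of size `η ≤ 1 / (L K T)`. -/
theorem norm_oracleRun_fst_sub_le (P : Problem Z d N) {c : Config d} (hη : 0 ≤ c.ηl)
    (hg : 0 ≤ c.ηg) {h : ℝ} (hh : c.ηg ≤ h) (hG0 : ∀ t, 0 ≤ c.gain t)
    (hG1 : ∀ t, c.gain t ≤ 1) {S K : ℕ}
    {L : ℝ} (hL : 0 ≤ L) {T : ℕ} (hηL : K * (c.ηl * L) * T ≤ 1)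
    {V : P.Oracle} (W : P.Oracle)
    (hV : ∀ k j w w', ‖V k j w - V k j w'‖ ≤ L * ‖w - w'‖) (w₀ : Model d)
    (ω : Fin T → RoundSeed P S K) :
    ‖(oracleRun P c V w₀ T ω).1 - (oracleRun P c W w₀ T ω).1‖ ≤
      stabilityConst h * T * runError P c V W w₀ T ω := by
  rcases Nat.eq_zero_or_pos T with rfl | hT
  · simp [oracleRun]
  have hT' : (1 : ℝ) ≤ T := by exact_mod_cast hT
  have hT0 : (0 : ℝ) < T := by linarith
  refine (norm_oracleRun_sub_le P hη hg hG0 hG1 hL hT' hηL W hV w₀ T ω le_rfl).2.trans ?_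
  have hE := runError_nonneg P hη V W w₀ T ω
  set Q := runError P c V W w₀ T ω
  have hx : 0 ≤ 4 * c.ηg / T := by positivity
  have h1 : 1 + 4 * c.ηg / T ≤ 1 + 4 * h := by
    have : 4 * c.ηg / T ≤ 4 * c.ηg := div_le_self (by positivity) hT'
    linarith
  have h2 : (1 + 4 * c.ηg / T) ^ T ≤ Real.exp (4 * h) := by
    calc (1 + 4 * c.ηg / T) ^ T ≤ Real.exp (4 * c.ηg / T) ^ T :=
          pow_le_pow_left₀ (by positivity) (by linarith [Real.add_one_le_exp (4 * c.ηg / T)]) T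
      _ = Real.exp (4 * c.ηg) := by rw [← Real.exp_nat_mul]; congr 1; field_simp
      _ ≤ _ := Real.exp_le_exp.mpr (by linarith)
  have h3 : (1 : ℝ) ≤ (1 + 4 * c.ηg / T) ^ T := one_le_pow₀ (by linarith)
  have h4 : (1 + 4 * c.ηg / T) * ((1 + 4 * c.ηg / T) ^ T - 1) ≤ stabilityConst h :=
    mul_le_mul h1 (by linarith) (by linarith) (by linarith)
  have h5 : 0 ≤ stabilityConst h := (mul_nonneg (by positivity) (by linarith)).trans h4
  have h6 : 0 ≤ Q * T := by positivity
  nlinarith [mul_le_mul_of_nonneg_left h4 h6, mul_nonneg h6 h5]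

/-! ### Resampling one coordinate of a product measure. -/

section Update

variable {ι : Type*} [Fintype ι] [DecidableEq ι] {X : ι → Type*} [∀ i, MeasurableSpace (X i)]

/-- Resampling one coordinate of a product of probability measures preserves the product. -/
theorem measurePreserving_update (μ : ∀ i, Measure (X i)) [∀ i, IsProbabilityMeasure (μ i)]
    (i : ι) :
    MeasurePreserving (fun p : (∀ j, X j) × X i => Function.update p.1 i p.2)
      ((Measure.pi μ).prod (μ i)) (Measure.pi μ) := by
  have hm : Measurable fun p : (∀ j, X j) × X i => Function.update p.1 i p.2 :=
    measurable_update'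
  refine ⟨hm, (Measure.pi_eq fun s hs => ?_).symm⟩
  rw [Measure.map_apply hm (MeasurableSet.univ_pi hs)]
  have : (fun p : (∀ j, X j) × X i => Function.update p.1 i p.2) ⁻¹' Set.univ.pi s =
      (Set.univ.pi (Function.update s i Set.univ)) ×ˢ s i := by
    ext p
    simp only [Set.mem_preimage, Set.mem_univ_pi, Set.mem_prod]
    constructor
    · refine fun h => ⟨fun j => ?_, by simpa using h i⟩
      by_cases hj : j = i
      · subst hj; simp
      · simpa [hj] using h j
    · rintro ⟨h1, h2⟩ j
      by_cases hj : j = i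
      · subst hj; simpa using h2
      · simpa [hj] using h1 j
  rw [this, Measure.prod_prod, Measure.pi_pi,
    ← Finset.prod_erase_mul _ (fun j => μ j (s j)) (Finset.mem_univ i),
    ← Finset.prod_erase_mul _ _ (Finset.mem_univ i)]
  simp only [Function.update_self, measure_univ, mul_one]
  congr 1
  refine Finset.prod_congr rfl fun j hj => ?_
  rw [Function.update_of_ne (Finset.ne_of_mem_erase hj)]

/-- A measure-preserving transformation of one coordinate that uses extra randomness preserves a
product of probability measures. -/
theorem measurePreserving_update_apply (μ : ∀ i, Measure (X i))
    [∀ i, IsProbabilityMeasure (μ i)] (i : ι) {Y : Type*} [MeasurableSpace Y] (ν : Measure Y)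
    [IsProbabilityMeasure ν] {B : X i × Y → X i}
    (hB : MeasurePreserving B ((μ i).prod ν) (μ i)) :
    MeasurePreserving (fun p : (∀ j, X j) × Y => Function.update p.1 i (B (p.1 i, p.2)))
      ((Measure.pi μ).prod ν) (Measure.pi μ) := by
  have hA := measurePreserving_update μ i
  have hm : Measurable fun p : (∀ j, X j) × Y => Function.update p.1 i (B (p.1 i, p.2)) := by
    refine measurable_update'.comp (measurable_fst.prodMk (hB.measurable.comp ?_))
    exact ((measurable_pi_apply i).comp measurable_fst).prodMk measurable_snd
  refine ⟨hm, ?_⟩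
  -- The product law is first written as its own image under resampling coordinate i. The
  -- transformation then overwrites a fresh independent value x by B (x, y), which is one update of
  -- the original point.
  have hAid := hA.prod (MeasurePreserving.id ν)
  have hassoc := measurePreserving_prodAssoc (Measure.pi μ) (μ i) ν
  have hcomp := hA.comp (((MeasurePreserving.id (Measure.pi μ)).prod hB).comp hassoc)
  rw [← hAid.map_eq, Measure.map_map hm hAid.measurable]
  refine Eq.trans ?_ hcomp.map_eq
  congr 1
  ext p j
  by_cases hj : j = i
  · subst hj; simp [MeasurableEquiv.prodAssoc]
  · simp [hj, MeasurableEquiv.prodAssoc]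

end Update

theorem norm_gradient_le_of_lipschitz {E : Type*} [NormedAddCommGroup E] [InnerProductSpace ℝ E]
    [CompleteSpace E] {f : E → ℝ} {C : ℝ} (hC : 0 ≤ C)
    (hf : ∀ w w', |f w - f w'| ≤ C * ‖w - w'‖) (w : E) : ‖gradient f w‖ ≤ C := by
  rw [gradient, LinearIsometryEquiv.norm_map]
  exact norm_fderiv_le_of_lip' ℝ hC (Filter.Eventually.of_forall fun v => hf v w)

theorem continuous_of_abs_sub_le {E : Type*} [NormedAddCommGroup E] {f : E → ℝ} {C : ℝ}
    (hC : 0 ≤ C) (hf : ∀ w w', |f w - f w'| ≤ C * ‖w - w'‖) : Continuous f :=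
  (LipschitzWith.of_dist_le_mul (K := ⟨C, hC⟩) fun w w' => by
    rw [Real.dist_eq, dist_eq_norm]; exact hf w w').continuous

/-! ### Replacing a sample by a fresh one. -/

/-- A sample: a client and an index of its training data. -/
abbrev Problem.Sample (P : Problem Z d N) : Type := (k : Fin N) × Fin (P.n k)

/-- The dataset `D` with the sample `s` replaced by `z`. -/
def Problem.setSample (P : Problem Z d N) (s : P.Sample) (D : P.Dataset) (z : Z) : P.Dataset :=
  Function.update D s.1 (Function.update (D s.1) s.2 z)

theorem Problem.setSample_self (P : Problem Z d N) (s : P.Sample) (D : P.Dataset) (z : Z) :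
    P.setSample s D z s.1 s.2 = z := by
  simp [Problem.setSample]

theorem Problem.setSample_of_ne (P : Problem Z d N) {s : P.Sample} (D : P.Dataset) (z : Z)
    {k : Fin N} {j : Fin (P.n k)} (h : (⟨k, j⟩ : P.Sample) ≠ s) :
    P.setSample s D z k j = D k j := by
  obtain ⟨k', j'⟩ := s
  by_cases hk : k = k'
  · subst hk
    have hj : j ≠ j' := fun h' => h (by rw [h'])
    simp [Problem.setSample, hj]
  · simp [Problem.setSample, hk]

instance (P : Problem Z d N) : IsProbabilityMeasure P.dataLaw := by
  unfold Problem.dataLaw; infer_instance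

theorem Problem.measurePreserving_setSample (P : Problem Z d N) (s : P.Sample) :
    MeasurePreserving (fun p : P.Dataset × Z => P.setSample s p.1 p.2)
      (P.dataLaw.prod (P.dist s.1)) P.dataLaw :=
  measurePreserving_update_apply (fun k => Measure.pi fun _ : Fin (P.n k) => P.dist k) s.1
    (P.dist s.1) (measurePreserving_update (fun _ : Fin (P.n s.1) => P.dist s.1) s.2)

theorem Problem.measurePreserving_sample (P : Problem Z d N) (s : P.Sample) :
    MeasurePreserving (fun D : P.Dataset => D s.1 s.2) P.dataLaw (P.dist s.1) :=
  (measurePreserving_eval (fun _ : Fin (P.n s.1) => P.dist s.1) s.2).comp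
    (measurePreserving_eval (fun k => Measure.pi fun _ : Fin (P.n k) => P.dist k) s.1)

/-- A quantity that depends on the sample `s` only through its second argument may be averaged
over a fresh sample. -/
theorem Problem.integral_fresh_sample (P : Problem Z d N) (μ₀ : Measure (Model d))
    [IsProbabilityMeasure μ₀] (s : P.Sample) {h : Model d × P.Dataset → Z → ℝ}
    (hinv : ∀ x z, h (x.1, P.setSample s x.2 z) = h x)
    (hint : Integrable (fun x => h x (x.2 s.1 s.2)) (μ₀.prod P.dataLaw)) :
    ∫ x, h x (x.2 s.1 s.2) ∂(μ₀.prod P.dataLaw) =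
      ∫ x, ∫ z, h x z ∂(P.dist s.1) ∂(μ₀.prod P.dataLaw) := by
  have hΦ : MeasurePreserving
      (fun p : (Model d × P.Dataset) × Z => (p.1.1, P.setSample s p.1.2 p.2))
      ((μ₀.prod P.dataLaw).prod (P.dist s.1)) (μ₀.prod P.dataLaw) :=
    ((MeasurePreserving.id μ₀).prod (P.measurePreserving_setSample s)).comp
      (measurePreserving_prodAssoc μ₀ P.dataLaw (P.dist s.1))
  -- After resampling, the slot s holds z while `h` still sees the old data, so the integrand
  -- becomes `h` at an independent sample.
  have heq : (fun x : Model d × P.Dataset => h x (x.2 s.1 s.2)) ∘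
      (fun p : (Model d × P.Dataset) × Z => (p.1.1, P.setSample s p.1.2 p.2)) =
      fun p => h p.1 p.2 := by
    funext p
    simp only [Function.comp, hinv, P.setSample_self]
  have hint' := hΦ.integrable_comp_of_integrable hint
  rw [heq] at hint'
  calc _ = ∫ p, (fun x : Model d × P.Dataset => h x (x.2 s.1 s.2)) ((p.1.1,
          P.setSample s p.1.2 p.2)) ∂((μ₀.prod P.dataLaw).prod (P.dist s.1)) := by
        rw [← hΦ.map_eq, integral_map hΦ.measurable.aemeasurable]
        · rw [hΦ.map_eq]
        · rw [hΦ.map_eq]; exact hint.aestronglyMeasurable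
    _ = ∫ p, h p.1 p.2 ∂((μ₀.prod P.dataLaw).prod (P.dist s.1)) := by
        simp only [hinv, P.setSample_self]
    _ = _ := integral_prod _ hint'

/-! ### Lipschitz bounds and measurability of the gradients. -/

section Regularity

variable {P : Problem Z d N} {Lp Lm : ℝ}

theorem Problem.abs_localRisk_sub_le (hl : P.LipschitzSmooth Lp Lm) (k : Fin N)
    (w w' : Model d) : |P.localRisk k w - P.localRisk k w'| ≤ Lp * ‖w - w'‖ := by
  rw [Problem.localRisk, Problem.localRisk,
    ← integral_sub (P.integrable_loss k w) (P.integrable_loss k w')]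
  refine (abs_integral_le_integral_abs).trans ?_
  refine (integral_mono ((P.integrable_loss k w).sub (P.integrable_loss k w')).abs
    (integrable_const _) fun z => hl.1 z w w').trans ?_
  simp

theorem Problem.norm_grad_le (hLp : 0 ≤ Lp) (hl : P.LipschitzSmooth Lp Lm) (w : Model d)
    (z : Z) : ‖P.grad w z‖ ≤ Lp :=
  norm_gradient_le_of_lipschitz hLp (hl.1 z) w

theorem Problem.norm_gradient_localRisk_le (hLp : 0 ≤ Lp) (hl : P.LipschitzSmooth Lp Lm)
    (k : Fin N) (w : Model d) : ‖gradient (P.localRisk k) w‖ ≤ Lp :=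
  norm_gradient_le_of_lipschitz hLp (P.abs_localRisk_sub_le hl k) w

theorem Problem.measurable_loss_uncurry (hLp : 0 ≤ Lp) (hl : P.LipschitzSmooth Lp Lm) :
    Measurable fun p : Model d × Z => P.loss p.1 p.2 :=
  measurable_uncurry_of_continuous_of_measurable
    (fun z => continuous_of_abs_sub_le hLp (hl.1 z)) P.measurable_loss

theorem Problem.measurable_grad (hl : P.LipschitzSmooth Lp Lm) (w : Model d) :
    Measurable (P.grad w) := by
  suffices h : ∀ j : Fin d, Measurable fun z => P.grad w z j by
    exact (MeasurableEquiv.toLp 2 (Fin d → ℝ)).measurable.comp (measurable_pi_iff.mpr h)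
  intro j
  -- Each partial derivative is a limit of difference quotients with step 1/(m + 1), hence of
  -- functions measurable in z.
  have hlim : ∀ z, Filter.Tendsto (fun m : ℕ => ((1 / ((m : ℝ) + 1)))⁻¹ *
      (P.loss (w + (1 / ((m : ℝ) + 1)) • EuclideanSpace.single j (1 : ℝ)) z - P.loss w z))
      Filter.atTop (nhds (P.grad w z j)) := by
    intro z
    have h1 : HasGradientAt (fun v => P.loss v z) (P.grad w z) w := (hl.2.1 z w).hasGradientAt
    have h2 := (h1.hasFDerivAt.hasLineDerivAt (EuclideanSpace.single j (1 : ℝ)))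
    have h3 := hasDerivAt_iff_tendsto_slope.mp h2
    have h4 : Filter.Tendsto (fun m : ℕ => 1 / ((m : ℝ) + 1)) Filter.atTop
        (nhdsWithin 0 {0}ᶜ) :=
      tendsto_nhdsWithin_iff.mpr ⟨tendsto_one_div_add_atTop_nhds_zero_nat,
        Filter.Eventually.of_forall fun m => by
          simp only [Set.mem_compl_iff, Set.mem_singleton_iff]; positivity⟩
    have h5 := h3.comp h4
    have h6 : (InnerProductSpace.toDual ℝ (Model d)) (P.grad w z)
        (EuclideanSpace.single j (1 : ℝ)) = P.grad w z j := by
      simp [EuclideanSpace.inner_single_right]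
    rw [h6] at h5
    refine h5.congr fun m => ?_
    simp [slope]
  refine measurable_of_tendsto_metrizable (fun m => ?_) (tendsto_pi_nhds.mpr hlim)
  exact ((P.measurable_loss _).sub (P.measurable_loss _)).const_mul _

theorem Problem.measurable_grad_uncurry (hLm : 0 ≤ Lm) (hl : P.LipschitzSmooth Lp Lm) :
    Measurable fun p : Model d × Z => P.grad p.1 p.2 :=
  measurable_uncurry_of_continuous_of_measurable
    (fun z => (LipschitzWith.of_dist_le_mul (K := ⟨Lm, hLm⟩) fun w w' => by
      rw [dist_eq_norm, dist_eq_norm]; exact hl.2.2 z w w').continuous)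
    (P.measurable_grad hl)

theorem measurable_gradient (f : Model d → ℝ) : Measurable (gradient f) :=
  (InnerProductSpace.toDual ℝ (Model d)).symm.continuous.measurable.comp
    (measurable_fderiv ℝ f)

end Regularity

/-! ### The oracle that ignores one sample. -/

open Classical in
/-- The oracle of the sample gradients, with the gradient of the local objective in the place of
the gradient of the sample `s`. -/
noncomputable def Problem.replacedOracle (P : Problem Z d N) (s : P.Sample) (D : P.Dataset) :
    P.Oracle :=
  fun k j w => if (⟨k, j⟩ : P.Sample) = s then gradient (P.localRisk k) w else P.grad w (D k j)

/-- This makes every point of the replaced run independent of the sample s. -/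
theorem Problem.replacedOracle_setSample (P : Problem Z d N) (s : P.Sample) (D : P.Dataset)
    (z : Z) : P.replacedOracle s (P.setSample s D z) = P.replacedOracle s D := by
  funext k j w
  unfold Problem.replacedOracle
  split_ifs with h
  · rfl
  · rw [P.setSample_of_ne D z h]

section Measurability

variable {α : Type*} [MeasurableSpace α]

theorem measurable_descent (η : ℝ) {m : ℕ} {V : α → Fin m → Model d → Model d}
    (hV : ∀ j, Measurable fun p : α × Model d => V p.1 j p.2) {X : α → Model d}
    (hX : Measurable X) (K : ℕ) (idx : Fin K → Fin m) :
    Measurable fun a => descent η (V a) (X a) K idx := by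
  induction K with
  | zero => exact hX
  | succ K ih =>
    have h1 := ih fun i => idx i.castSucc
    exact h1.sub (((hV (idx (Fin.last K))).comp (measurable_id.prodMk h1)).const_smul η)

theorem measurable_oracleRun (P : Problem Z d N) (c : Config d) {S K : ℕ} {V : α → P.Oracle}
    (hV : ∀ k j, Measurable fun p : α × Model d => V p.1 k j p.2) {X : α → Model d}
    (hX : Measurable X) (T : ℕ) (ω : Fin T → RoundSeed P S K) :
    Measurable fun a => oracleRun P c (V a) (X a) T ω := by
  induction T with
  | zero => exact hX.prodMk measurable_const
  | succ t ih =>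
    have h0 := ih fun i => ω i.castSucc
    have h1 := h0.fst
    have h2 := h0.snd
    have hŵ : Measurable fun a => (oracleRun P c (V a) (X a) t fun i => ω i.castSucc).1 -
        c.ηg • (oracleRun P c (V a) (X a) t fun i => ω i.castSucc).2 :=
      h1.sub (h2.const_smul c.ηg)
    have hu : Measurable fun a => oracleUpdate P c (V a) (ω (Fin.last t))
        ((oracleRun P c (V a) (X a) t fun i => ω i.castSucc).1 -
        c.ηg • (oracleRun P c (V a) (X a) t fun i => ω i.castSucc).2) :=
      Finset.measurable_sum _ fun k _ =>
        (hŵ.sub (measurable_descent c.ηl (V := fun a => V a k) (hV k) hŵ K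
          ((ω (Fin.last t)).2 k))).const_smul (P.weight c.weighting (ω (Fin.last t)).1.1 k)
    have hM := h2.add ((hu.sub h2).const_smul (c.gain t))
    exact (h1.sub (hM.const_smul c.ηg)).prodMk hM

end Measurability

/-! ### Expected oracle errors, summed over the replaced sample. -/

section Oracles

variable {P : Problem Z d N} {Lp Lm : ℝ}

theorem Problem.measurable_sampleOracle (hLm : 0 ≤ Lm) (hl : P.LipschitzSmooth Lp Lm) (k : Fin N)
    (j : Fin (P.n k)) :
    Measurable fun p : (Model d × P.Dataset) × Model d => P.sampleOracle p.1.2 k j p.2 :=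
  (P.measurable_grad_uncurry hLm hl).comp <| measurable_snd.prodMk <|
    (measurable_pi_apply j).comp <| (measurable_pi_apply k).comp <|
      measurable_snd.comp measurable_fst

theorem Problem.measurable_replacedOracle (hLm : 0 ≤ Lm) (hl : P.LipschitzSmooth Lp Lm)
    (s : P.Sample) (k : Fin N) (j : Fin (P.n k)) :
    Measurable fun p : (Model d × P.Dataset) × Model d => P.replacedOracle s p.1.2 k j p.2 := by
  unfold Problem.replacedOracle
  split_ifs with h
  · exact (measurable_gradient _).comp measurable_snd
  · exact P.measurable_sampleOracle hLm hl k j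

theorem Problem.norm_sampleOracle_le (hLp : 0 ≤ Lp) (hl : P.LipschitzSmooth Lp Lm)
    (D : P.Dataset) (k : Fin N) (j : Fin (P.n k)) (w : Model d) :
    ‖P.sampleOracle D k j w‖ ≤ Lp :=
  P.norm_grad_le hLp hl w _

theorem Problem.norm_replacedOracle_le (hLp : 0 ≤ Lp) (hl : P.LipschitzSmooth Lp Lm)
    (s : P.Sample) (D : P.Dataset) (k : Fin N) (j : Fin (P.n k)) (w : Model d) :
    ‖P.replacedOracle s D k j w‖ ≤ Lp := by
  unfold Problem.replacedOracle
  split_ifs with h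
  · exact P.norm_gradient_localRisk_le hLp hl k w
  · exact P.norm_grad_le hLp hl w _

variable {σ : ℝ}

/-- Summed over the sample that is replaced, the expected error of one oracle call is at most the
local variance. -/
theorem Problem.sum_integral_oracleError_le (hLp : 0 ≤ Lp) (hLm : 0 ≤ Lm)
    (hl : P.LipschitzSmooth Lp Lm) (hσ : P.LocalVariance σ) (μ₀ : Measure (Model d))
    [IsProbabilityMeasure μ₀] (k : Fin N) (j : Fin (P.n k))
    {Y : P.Sample → Model d × P.Dataset → Model d} (hY : ∀ s, Measurable (Y s))
    (hinv : ∀ s x z, Y s (x.1, P.setSample s x.2 z) = Y s x) :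
    (∀ s, Integrable (fun x : Model d × P.Dataset =>
      ‖P.sampleOracle x.2 k j (Y s x) - P.replacedOracle s x.2 k j (Y s x)‖)
      (μ₀.prod P.dataLaw)) ∧
    ∑ s, ∫ x : Model d × P.Dataset,
      ‖P.sampleOracle x.2 k j (Y s x) - P.replacedOracle s x.2 k j (Y s x)‖
      ∂(μ₀.prod P.dataLaw) ≤ σ := by
  classical
  have hint : ∀ s, Integrable (fun x : Model d × P.Dataset =>
      ‖P.sampleOracle x.2 k j (Y s x) - P.replacedOracle s x.2 k j (Y s x)‖)
      (μ₀.prod P.dataLaw) := by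
    intro s
    have hm1 := (P.measurable_sampleOracle hLm hl k j).comp (measurable_id.prodMk (hY s))
    have hm2 := (P.measurable_replacedOracle hLm hl s k j).comp (measurable_id.prodMk (hY s))
    refine Integrable.of_bound (hm1.sub hm2).norm.aestronglyMeasurable (Lp + Lp)
      (Filter.Eventually.of_forall fun x => ?_)
    rw [norm_norm]
    exact (norm_sub_le _ _).trans (add_le_add (P.norm_sampleOracle_le hLp hl _ _ _ _)
      (P.norm_replacedOracle_le hLp hl _ _ _ _ _))
  refine ⟨hint, ?_⟩
  -- The two oracles differ at (k, j) only if (k, j) is the replaced sample. This is why the sum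
  -- over s costs one σ rather than n of them.
  rw [Finset.sum_eq_single (⟨k, j⟩ : P.Sample)]
  · set s : P.Sample := ⟨k, j⟩
    have heq : (fun x : Model d × P.Dataset =>
        ‖P.sampleOracle x.2 k j (Y s x) - P.replacedOracle s x.2 k j (Y s x)‖) =
        fun x => ‖P.grad (Y s x) (x.2 s.1 s.2) - gradient (P.localRisk s.1) (Y s x)‖ := by
      funext x
      have : P.replacedOracle s x.2 k j = gradient (P.localRisk k) := funext fun w => if_pos rfl
      rw [this]
      rfl
    have hi := hint s
    rw [heq] at hi ⊢
    rw [P.integral_fresh_sample μ₀ s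
      (h := fun x z => ‖P.grad (Y s x) z - gradient (P.localRisk s.1) (Y s x)‖)
      (fun x z => by simp only [hinv]) hi]
    have hb : ∀ x, ‖∫ z, ‖P.grad (Y s x) z - gradient (P.localRisk s.1) (Y s x)‖
        ∂(P.dist s.1)‖ ≤ σ := fun x => by
      rw [Real.norm_of_nonneg (integral_nonneg fun z => norm_nonneg _)]
      exact hσ s.1 (Y s x)
    have := norm_integral_le_of_norm_le_const (μ := μ₀.prod P.dataLaw)
      (Filter.Eventually.of_forall hb)
    simpa using (le_abs_self _).trans this
  · intro s _ hs
    have : (fun x : Model d × P.Dataset =>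
        ‖P.sampleOracle x.2 k j (Y s x) - P.replacedOracle s x.2 k j (Y s x)‖) = 0 := by
      funext x
      simp [Problem.sampleOracle, Problem.replacedOracle, Ne.symm hs]
    rw [this]
    simp
  · intro h
    exact absurd (Finset.mem_univ _) h

/-- The errors are measured along the path of the replaced oracle, so its points are admissible
evaluation points `Y s` for the one-call bound. -/
theorem Problem.sum_integral_descentError_le (hLp : 0 ≤ Lp) (hLm : 0 ≤ Lm)
    (hl : P.LipschitzSmooth Lp Lm) (hσ : P.LocalVariance σ) (μ₀ : Measure (Model d))
    [IsProbabilityMeasure μ₀] {η : ℝ} (hη : 0 ≤ η) (k : Fin N)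
    {Y : P.Sample → Model d × P.Dataset → Model d} (hY : ∀ s, Measurable (Y s))
    (hinv : ∀ s x z, Y s (x.1, P.setSample s x.2 z) = Y s x) (K : ℕ)
    (idx : Fin K → Fin (P.n k)) :
    (∀ s, Integrable (fun x : Model d × P.Dataset =>
      descentError η (P.sampleOracle x.2 k) (P.replacedOracle s x.2 k) (Y s x) K idx)
      (μ₀.prod P.dataLaw)) ∧
    ∑ s, ∫ x : Model d × P.Dataset,
      descentError η (P.sampleOracle x.2 k) (P.replacedOracle s x.2 k) (Y s x) K idx
      ∂(μ₀.prod P.dataLaw) ≤ K * (η * σ) := by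
  induction K with
  | zero => simp [descentError]
  | succ K ih =>
    obtain ⟨h1, h2⟩ := ih fun i => idx i.castSucc
    obtain ⟨h3, h4⟩ := P.sum_integral_oracleError_le hLp hLm hl hσ μ₀ k (idx (Fin.last K))
      (Y := fun s x => descent η (P.replacedOracle s x.2 k) (Y s x) K fun i => idx i.castSucc)
      (fun s => measurable_descent η (V := fun x : Model d × P.Dataset => P.replacedOracle s x.2 k)
        (P.measurable_replacedOracle hLm hl s k) (hY s) K _)
      (fun s x z => by simp only [hinv, P.replacedOracle_setSample])
    simp only [descentError]
    refine ⟨fun s => (h1 s).add ((h3 s).const_mul η), ?_⟩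
    calc _ = ∑ s, (∫ x : Model d × P.Dataset, descentError η (P.sampleOracle x.2 k)
            (P.replacedOracle s x.2 k) (Y s x) K (fun i => idx i.castSucc)
            ∂(μ₀.prod P.dataLaw) + η * _) :=
          Finset.sum_congr rfl fun s _ => by
            rw [integral_add (h1 s) ((h3 s).const_mul η), integral_const_mul]
      _ ≤ K * (η * σ) + η * σ := by
          rw [Finset.sum_add_distrib, ← Finset.mul_sum]
          exact add_le_add h2 (mul_le_mul_of_nonneg_left h4 hη)
      _ = _ := by push_cast; ring

theorem Problem.sum_integral_roundError_le (hLp : 0 ≤ Lp) (hLm : 0 ≤ Lm)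
    (hl : P.LipschitzSmooth Lp Lm) (hσ : P.LocalVariance σ) (hσ0 : 0 ≤ σ)
    (μ₀ : Measure (Model d)) [IsProbabilityMeasure μ₀] {c : Config d} (hη : 0 ≤ c.ηl)
    {Y : P.Sample → Model d × P.Dataset → Model d} (hY : ∀ s, Measurable (Y s))
    (hinv : ∀ s x z, Y s (x.1, P.setSample s x.2 z) = Y s x) {S K : ℕ}
    (ω : RoundSeed P S K) :
    (∀ s, Integrable (fun x : Model d × P.Dataset =>
      roundError P c (P.sampleOracle x.2) (P.replacedOracle s x.2) ω (Y s x))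
      (μ₀.prod P.dataLaw)) ∧
    ∑ s, ∫ x : Model d × P.Dataset,
      roundError P c (P.sampleOracle x.2) (P.replacedOracle s x.2) ω (Y s x)
      ∂(μ₀.prod P.dataLaw) ≤ K * (c.ηl * σ) := by
  have h := fun k => P.sum_integral_descentError_le hLp hLm hl hσ μ₀ hη k hY hinv K (ω.2 k)
  have hi : ∀ s k, Integrable (fun x : Model d × P.Dataset =>
      P.weight c.weighting ω.1.1 k * descentError c.ηl (P.sampleOracle x.2 k)
        (P.replacedOracle s x.2 k) (Y s x) K (ω.2 k)) (μ₀.prod P.dataLaw) :=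
    fun s k => ((h k).1 s).const_mul _
  simp only [roundError]
  refine ⟨fun s => integrable_finsetSum _ fun k _ => hi s k, ?_⟩
  simp_rw [integral_finsetSum _ fun k _ => hi _ k, integral_const_mul]
  rw [Finset.sum_comm]
  simp_rw [← Finset.mul_sum]
  exact P.sum_weight_mul_le _ _ (by positivity) fun k => (h k).2

/-- Summed over the sample that is replaced, the expected error of the oracle along the run. -/
theorem Problem.sum_integral_runError_le (hLp : 0 ≤ Lp) (hLm : 0 ≤ Lm)
    (hl : P.LipschitzSmooth Lp Lm) (hσ : P.LocalVariance σ) (hσ0 : 0 ≤ σ)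
    (μ₀ : Measure (Model d)) [IsProbabilityMeasure μ₀] {c : Config d} (hη : 0 ≤ c.ηl)
    {S K : ℕ} (T : ℕ) (ω : Fin T → RoundSeed P S K) :
    (∀ s, Integrable (fun x : Model d × P.Dataset =>
      runError P c (P.sampleOracle x.2) (P.replacedOracle s x.2) x.1 T ω)
      (μ₀.prod P.dataLaw)) ∧
    ∑ s, ∫ x : Model d × P.Dataset,
      runError P c (P.sampleOracle x.2) (P.replacedOracle s x.2) x.1 T ω
      ∂(μ₀.prod P.dataLaw) ≤ T * (K * (c.ηl * σ)) := by
  induction T with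
  | zero => simp [runError]
  | succ t ih =>
    obtain ⟨h1, h2⟩ := ih fun i => ω i.castSucc
    obtain ⟨h3, h4⟩ := P.sum_integral_roundError_le hLp hLm hl hσ hσ0 μ₀ hη
      (Y := fun s x => oracleLookahead P c (P.replacedOracle s x.2) x.1 t fun i => ω i.castSucc)
      (fun s => by
        have hm := measurable_oracleRun P c
          (V := fun x : Model d × P.Dataset => P.replacedOracle s x.2)
          (P.measurable_replacedOracle hLm hl s) measurable_fst t fun i => ω i.castSucc
        exact hm.fst.sub (hm.snd.const_smul c.ηg))
      (fun s x z => by simp only [P.replacedOracle_setSample]) (ω (Fin.last t))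
    simp only [runError]
    refine ⟨fun s => (h1 s).add (h3 s), ?_⟩
    simp_rw [fun s => integral_add (h1 s) (h3 s)]
    rw [Finset.sum_add_distrib]
    refine (add_le_add h2 h4).trans (le_of_eq ?_)
    push_cast
    ring

end Oracles

/-! ### From stability to the generalization gap. -/

section Generalization

variable {P : Problem Z d N} {Lp Lm : ℝ}

theorem Problem.abs_excess_sub_le (hl : P.LipschitzSmooth Lp Lm) (k : Fin N) (z : Z)
    (w w' : Model d) :
    |(P.localRisk k w - P.loss w z) - (P.localRisk k w' - P.loss w' z)| ≤
      2 * Lp * ‖w - w'‖ := by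
  have h1 := P.abs_localRisk_sub_le hl k w w'
  have h2 := hl.1 z w w'
  rw [abs_le] at *
  constructor <;> linarith [h1.1, h1.2, h2.1, h2.2]

/-- The excess risk on one sample is integrable at a model close to the initial one. -/
theorem Problem.integrable_excess (hLp : 0 ≤ Lp) (hl : P.LipschitzSmooth Lp Lm)
    {μ₀ : Measure (Model d)} [IsProbabilityMeasure μ₀]
    (hμ₀ : Integrable (fun w : Model d => w) μ₀) (s : P.Sample)
    {X : Model d × P.Dataset → Model d} (hX : Measurable X) {R : ℝ}
    (hR : ∀ x, ‖X x - x.1‖ ≤ R) :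
    Integrable (fun x => P.localRisk s.1 (X x) - P.loss (X x) (x.2 s.1 s.2))
      (μ₀.prod P.dataLaw) := by
  have hs : MeasurePreserving (fun x : Model d × P.Dataset => x.2 s.1 s.2)
      (μ₀.prod P.dataLaw) (P.dist s.1) :=
    (P.measurePreserving_sample s).comp measurePreserving_snd
  have h0 : Integrable (fun x : Model d × P.Dataset =>
      P.localRisk s.1 0 - P.loss 0 (x.2 s.1 s.2)) (μ₀.prod P.dataLaw) :=
    (integrable_const _).sub (hs.integrable_comp_of_integrable (P.integrable_loss s.1 0))
  have h1 : Integrable (fun x : Model d × P.Dataset => ‖x.1‖) (μ₀.prod P.dataLaw) :=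
    (measurePreserving_fst.integrable_comp_of_integrable hμ₀).norm
  have hm : Measurable fun x => P.localRisk s.1 (X x) - P.loss (X x) (x.2 s.1 s.2) :=
    ((continuous_of_abs_sub_le hLp (P.abs_localRisk_sub_le hl s.1)).measurable.comp hX).sub
      ((P.measurable_loss_uncurry hLp hl).comp (hX.prodMk hs.measurable))
  -- The excess is 2 L_p-Lipschitz in the model, so it is dominated by its value at 0 plus a
  -- multiple of R + ‖w₀‖.
  refine Integrable.mono' (h0.norm.add (((integrable_const R).add h1).const_mul (2 * Lp)))
    hm.aestronglyMeasurable (Filter.Eventually.of_forall fun x => ?_)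
  have h2 := P.abs_excess_sub_le hl s.1 (x.2 s.1 s.2) (X x) 0
  have h3 : ‖X x - 0‖ ≤ R + ‖x.1‖ := by
    have : X x - 0 = (X x - x.1) + x.1 := by abel
    rw [this]
    exact (norm_add_le _ _).trans (add_le_add (hR x) le_rfl)
  have h4 := mul_le_mul_of_nonneg_left h3 (by positivity : 0 ≤ 2 * Lp)
  have h5 := abs_sub_abs_le_abs_sub (P.localRisk s.1 (X x) - P.loss (X x) (x.2 s.1 s.2))
    (P.localRisk s.1 0 - P.loss 0 (x.2 s.1 s.2))
  simp only [Pi.add_apply, Real.norm_eq_abs]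
  linarith

theorem Problem.integral_excess_eq_zero (hLp : 0 ≤ Lp) (hl : P.LipschitzSmooth Lp Lm)
    {μ₀ : Measure (Model d)} [IsProbabilityMeasure μ₀]
    (hμ₀ : Integrable (fun w : Model d => w) μ₀) (s : P.Sample)
    {X : Model d × P.Dataset → Model d} (hX : Measurable X) {R : ℝ}
    (hR : ∀ x, ‖X x - x.1‖ ≤ R) (hinv : ∀ x z, X (x.1, P.setSample s x.2 z) = X x) :
    ∫ x, (P.localRisk s.1 (X x) - P.loss (X x) (x.2 s.1 s.2)) ∂(μ₀.prod P.dataLaw) = 0 := by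
  rw [P.integral_fresh_sample μ₀ s (h := fun x z => P.localRisk s.1 (X x) - P.loss (X x) z)
    (fun x z => by simp only [hinv]) (P.integrable_excess hLp hl hμ₀ s hX hR)]
  have : ∀ x, ∫ z, (P.localRisk s.1 (X x) - P.loss (X x) z) ∂(P.dist s.1) = 0 := fun x => by
    rw [integral_sub (integrable_const _) (P.integrable_loss _ _)]
    simp [Problem.localRisk]
  simp [this]

theorem Problem.risk_sub_empRisk (P : Problem Z d N) (D : P.Dataset) (w : Model d) :
    P.risk w - P.empRisk D w =
      (∑ s : P.Sample, (P.localRisk s.1 w - P.loss w (D s.1 s.2))) / (P.total : ℝ) := by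
  rw [Problem.risk, Problem.empRisk, ← Finset.sum_sub_distrib, Fintype.sum_sigma,
    Finset.sum_div]
  refine Finset.sum_congr rfl fun k _ => ?_
  have hn : (P.n k : ℝ) ≠ 0 := by exact_mod_cast (P.n_pos k).ne'
  simp only [Finset.sum_sub_distrib, Finset.sum_const, Finset.card_univ, Fintype.card_fin,
    nsmul_eq_mul, Problem.p]
  field_simp

/-- The generalization bound for a fixed choice of the clients and of the sample indices. -/
theorem abs_integral_risk_sub_empRisk_le (hLp : 0 ≤ Lp) (hLm : 0 < Lm)
    (hl : P.LipschitzSmooth Lp Lm) {σ : ℝ} (hσ : P.LocalVariance σ) (hσ0 : 0 ≤ σ)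
    {μ₀ : Measure (Model d)} [IsProbabilityMeasure μ₀]
    (hμ₀ : Integrable (fun w : Model d => w) μ₀) {c : Config d} (hη : 0 ≤ c.ηl)
    (hg : 0 ≤ c.ηg) {h : ℝ} (hh : c.ηg ≤ h) (hG0 : ∀ t, 0 ≤ c.gain t)
    (hG1 : ∀ t, c.gain t ≤ 1) {S K T : ℕ} (hηL : K * (c.ηl * Lm) * T ≤ 1)
    (ω : Fin T → RoundSeed P S K) :
    Integrable (fun x : Model d × P.Dataset => P.risk (run P c x.2 x.1 T ω).1 -
      P.empRisk x.2 (run P c x.2 x.1 T ω).1) (μ₀.prod P.dataLaw) ∧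
    |∫ x : Model d × P.Dataset, (P.risk (run P c x.2 x.1 T ω).1 -
      P.empRisk x.2 (run P c x.2 x.1 T ω).1) ∂(μ₀.prod P.dataLaw)| ≤
      2 * stabilityConst h * (Lp / (P.total * Lm)) * (T * σ) := by
  set A : ℝ := 2 * Lp * (stabilityConst h * T) with hA
  have hh0 : 0 ≤ h := hg.trans hh
  have hC : 0 ≤ stabilityConst h := by unfold stabilityConst; positivity
  have hA0 : 0 ≤ A := by positivity
  have hm := measurable_oracleRun P c
    (V := fun x : Model d × P.Dataset => P.sampleOracle x.2)
    (P.measurable_sampleOracle hLm.le hl) measurable_fst T ω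
  have hR := fun x : Model d × P.Dataset => (norm_oracleRun_le P hη hg hG0 hG1 hLp
    (P.norm_sampleOracle_le hLp hl x.2) x.1 T ω).2
  have hint := fun s => P.integrable_excess hLp hl hμ₀ s hm.fst hR
  obtain ⟨hEi, hEs⟩ := P.sum_integral_runError_le hLp hLm.le hl hσ hσ0 μ₀ hη T ω
  have hs : ∀ s : P.Sample, |∫ x : Model d × P.Dataset,
      (P.localRisk s.1 (oracleRun P c (P.sampleOracle x.2) x.1 T ω).1 -
        P.loss (oracleRun P c (P.sampleOracle x.2) x.1 T ω).1 (x.2 s.1 s.2))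
        ∂(μ₀.prod P.dataLaw)| ≤
      A * ∫ x : Model d × P.Dataset,
        runError P c (P.sampleOracle x.2) (P.replacedOracle s x.2) x.1 T ω
        ∂(μ₀.prod P.dataLaw) := by
    intro s
    have hm' := measurable_oracleRun P c
      (V := fun x : Model d × P.Dataset => P.replacedOracle s x.2)
      (P.measurable_replacedOracle hLm.le hl s) measurable_fst T ω
    have hR' := fun x : Model d × P.Dataset => (norm_oracleRun_le P hη hg hG0 hG1 hLp
      (P.norm_replacedOracle_le hLp hl s x.2) x.1 T ω).2
    have hint' := P.integrable_excess hLp hl hμ₀ s hm'.fst hR'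
    have h0 := P.integral_excess_eq_zero hLp hl hμ₀ s hm'.fst hR'
      (fun x z => by simp only [P.replacedOracle_setSample])
    -- Subtracting the vanishing expected excess of the replaced run leaves a difference controlled
    -- by the distance of the two models.
    rw [← sub_zero (∫ x : Model d × P.Dataset, _ ∂(μ₀.prod P.dataLaw)), ← h0,
      ← integral_sub (hint s) hint', ← integral_const_mul]
    refine abs_integral_le_integral_abs.trans
      (integral_mono ((hint s).sub hint').abs ((hEi s).const_mul A) fun x => ?_)
    refine (P.abs_excess_sub_le hl _ _ _ _).trans ?_
    have := norm_oracleRun_fst_sub_le P hη hg hh hG0 hG1 hLm.le hηL (P.replacedOracle s x.2)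
      (V := P.sampleOracle x.2) (fun k j w w' => hl.2.2 _ w w') x.1 ω
    simp only [hA]
    rw [mul_assoc (2 * Lp)]
    exact mul_le_mul_of_nonneg_left this (by positivity)
  simp_rw [run_eq_oracleRun, P.risk_sub_empRisk]
  refine ⟨(integrable_finsetSum _ fun s _ => hint s).div_const _, ?_⟩
  rw [integral_div, integral_finsetSum _ fun s _ => hint s, abs_div, Nat.abs_cast]
  have hsum : |∑ s : P.Sample, ∫ x : Model d × P.Dataset,
      (P.localRisk s.1 (oracleRun P c (P.sampleOracle x.2) x.1 T ω).1 -
        P.loss (oracleRun P c (P.sampleOracle x.2) x.1 T ω).1 (x.2 s.1 s.2))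
        ∂(μ₀.prod P.dataLaw)| ≤ A * (σ / Lm) := by
    refine (Finset.abs_sum_le_sum_abs _ _).trans ((Finset.sum_le_sum fun s _ => hs s).trans ?_)
    rw [← Finset.mul_sum]
    refine mul_le_mul_of_nonneg_left (hEs.trans ?_) hA0
    rw [le_div_iff₀ hLm]
    calc T * (K * (c.ηl * σ)) * Lm = K * (c.ηl * Lm) * T * σ := by ring
      _ ≤ σ := mul_le_of_le_one_left hσ0 hηL
  refine (div_le_div_of_nonneg_right hsum (Nat.cast_nonneg _)).trans (le_of_eq ?_)
  rw [hA]
  simp only [div_eq_mul_inv, mul_inv]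
  ring

end Generalization

end FedEve

/-! ### The main theorem. -/

theorem mainTheorem3 (ηmax : ℝ) :
    ∃ C : ℝ, 0 < C ∧
      ∀ {Z : Type*} [MeasurableSpace Z] {d N : ℕ} (P : FedEve.Problem Z d N)
        (c : FedEve.Config d) (μ₀ : Measure (FedEve.Model d)) [IsProbabilityMeasure μ₀]
        (S K T : ℕ) (Lp Lm σl σg σ G Gkal : ℝ),
        1 ≤ S → S ≤ N → 1 ≤ K →
        Integrable (fun w : FedEve.Model d => w) μ₀ →
        BddBelow (Set.range P.risk) →
        0 ≤ Lp → 0 < Lm →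
        P.LipschitzSmooth Lp Lm →
        P.LocalVariance σl → P.GlobalVariance σg → P.LocalVariance σ →
        P.BoundedGradients G →
        0 < c.ηg → c.ηg ≤ ηmax →
        0 ≤ c.var₀ → (∀ t, 0 ≤ c.varQ t) → (∀ t, 0 ≤ c.varR t) →
        (∀ t < T, c.gain t ≤ Gkal) →
        0 < c.ηl → (∀ t < T, c.ηl ≤ 1 / (Lm * (K : ℝ) * ((t : ℝ) + 1))) →
        Integrable (FedEve.gap P c S K T) (μ₀.prod P.dataLaw) ∧
        |FedEve.genError P c μ₀ S K T| ≤
          C * (Lp / ((P.total : ℝ) * Lm)) *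
            ((T : ℝ) * (σl + σg) + Real.sqrt ((T : ℝ) * Lm * P.initialGap μ₀) +
              (T : ℝ) * Real.sqrt (Gkal ^ 2 * σ ^ 2 / (S : ℝ))) := by
  -- The absolute value makes the constant positive for every real `ηmax`.
  refine ⟨2 * FedEve.stabilityConst |ηmax|, by unfold FedEve.stabilityConst; positivity, ?_⟩
  intro Z _ d N P c μ₀ _ S K T Lp Lm σl σg σ G Gkal hS hSN hK hμ₀ _ hLp hLm hl hσl hσg _ _
    hg hgmax h₀ hQ hR _ hη hηt
  have k : Fin N := ⟨0, by omega⟩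
  have hσl0 : 0 ≤ σl := (integral_nonneg fun z => norm_nonneg _).trans (hσl k 0)
  have hσg0 : 0 ≤ σg := (norm_nonneg _).trans (hσg k 0)
  -- The step size is constant, so the condition of the last round, t = T - 1, gives η_l ≤ 1/(L_m K
  -- T).
  have hηL : K * (c.ηl * Lm) * T ≤ 1 := by
    cases T with
    | zero => simp
    | succ t =>
      have h1 := hηt t (Nat.lt_succ_self t)
      have hK0 : (0 : ℝ) < K := by exact_mod_cast hK
      rw [le_div_iff₀ (by positivity)] at h1
      push_cast
      linarith
  have hω := FedEve.abs_integral_risk_sub_empRisk_le hLp hLm hl hσl hσl0 hμ₀ hη.le hg.le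
    (hgmax.trans (le_abs_self ηmax)) (FedEve.Config.gain_nonneg h₀ hQ hR)
    (FedEve.Config.gain_le_one h₀ hQ hR) (S := S) hηL
  refine ⟨(integrable_finsetSum _ fun ω _ => (hω ω).1).div_const _, ?_⟩
  have hC : 0 ≤ 2 * FedEve.stabilityConst |ηmax| * (Lp / (P.total * Lm)) := by
    unfold FedEve.stabilityConst; positivity
  -- The bound holds for every fixed seed, hence for the average over the seeds.
  have hb : |FedEve.genError P c μ₀ S K T| ≤
      2 * FedEve.stabilityConst |ηmax| * (Lp / (P.total * Lm)) * (T * σl) := by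
    unfold FedEve.genError FedEve.gap
    rw [integral_div, integral_finsetSum _ fun ω _ => (hω ω).1, abs_div, Nat.abs_cast]
    refine div_le_of_le_mul₀ (Nat.cast_nonneg _) (by positivity) ?_
    refine (Finset.abs_sum_le_sum_abs _ _).trans
      ((Finset.sum_le_sum fun ω _ => (hω ω).2).trans (le_of_eq ?_))
    rw [Finset.sum_const, nsmul_eq_mul, Finset.card_univ, mul_comm]
  refine hb.trans (mul_le_mul_of_nonneg_left ?_ hC)
  have h1 : 0 ≤ (T : ℝ) * σg := by positivity
  have h2 := Real.sqrt_nonneg ((T : ℝ) * Lm * P.initialGap μ₀)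
  have h3 : 0 ≤ (T : ℝ) * Real.sqrt (Gkal ^ 2 * σ ^ 2 / (S : ℝ)) := by positivity
  linarith
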